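/- Let $(X,d)$ be a Hadamard space, i.e. a complete CAT(0) space, and let $o\in X$ be fixed. For $x,y\in X$ and $\lambda\in[0,1]$, let $\lambda x\oplus(1-\lambda)y$ denote the unique point $z$ of the geodesic segment $[x,y]$ with $d(z,x)=(1-\lambda)d(x,y)$ and $d(z,y)=\lambda d(x,y)$. Let $C\subseteq X$ be nonempty, closed and convex (i.e. $[x,y]\subseteq C$ for all $x,y\in C$), and let $P_C:X\to C$ be the metric projection, so that $P_Cx$ is the unique point of $C$ nearest to $x$. Let $T:C\to C$ be nonexpansive, i.e. $d(Tx,Ty)\le d(x,y)$ for all $x,y\in C$, with $F(T)=\{x\in C: Tx=x\}\neq\emptyset$. Let $(\alpha_n)_{n\ge 0}$ and $(\beta_n)_{n\ge 0}$ be sequences in $(0,1)$, let $(u_n)_{n\ge 0}$ be a sequence in $X$, and suppose that (i) $\lim_{n\to\infty}\alpha_n=0$ and $\sum_{n=0}^\infty\alpha_n=\infty$; (ii) $0<\liminf_{n\to\infty}\beta_n\le\limsup_{n\to\infty}\beta_n<1$; (iii) $\sum_{n=0}^\infty\alpha_n\,d(u_n,o)<\infty$. Let $x_0\in C$ be arbitrary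 and, for $n\ge 0$, let $$y_n=\alpha_nu_n\oplus(1-\alpha_n)Tx_n,\qquad x_{n+1}=(1-\beta_n)x_n\oplus\beta_nP_Cy_n .$$ Then $(x_n)$ converges in the metric $d$ to a point $q\in F(T)$. Moreover, $q$ is the limit of the implicit scheme: for every sequence $(\alpha'_m)$ in $(0,1)$ with $\alpha'_m\to 0$ and every sequence $(u'_m)$ in $X$ with $d(u'_m,o)\to 0$, there is exactly one sequence $(x'_m)$ in $C$ with $$x'_m=P_C\bigl(\alpha'_mu'_m\oplus(1-\alpha'_m)Tx'_m\bigr)\quad\text{for all }m,$$ and $x'_m\to q$ as $m\to\infty$. -/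

import Mathlib

open Filter Topology

namespace CATZero

variable {X : Type*} [MetricSpace X]

/-- `S` is a geodesic segment joining `x` to `y`: the image of `[0, d(x,y)]` under a
distance preserving map sending `0` to `x` and `d(x,y)` to `y`. -/
def IsGeodesicSegment (S : Set X) (x y : X) : Prop :=
  ∃ γ : ℝ → X, γ 0 = x ∧ γ (dist x y) = y ∧
    (∀ s ∈ Set.Icc 0 (dist x y), ∀ t ∈ Set.Icc 0 (dist x y), dist (γ s) (γ t) = |s - t|) ∧
    S = γ '' Set.Icc 0 (dist x y)

/-- CAT(0) spaces: geodesically connected, and every geodesic triangle is at least as thin as its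
comparison triangle in the Euclidean plane. In `thin`, `S` and `R` are two sides of a geodesic
triangle with vertices `x, y, z`, issuing from the vertex `x` (which is an arbitrary one of
the three vertices); `p ∈ S` and `q ∈ R` are points on these sides, `x', y', z'` is a
comparison triangle, and `p', q'` are the comparison points of `p, q`. (For two points on
the same side the comparison inequality is always an equality.) -/
structure IsCATZero (X : Type*) [MetricSpace X] : Prop where
  geodesic : ∀ x y : X, ∃ S : Set X, IsGeodesicSegment S x y
  thin : ∀ (x y z : X) (S R : Set X), IsGeodesicSegment S x y → IsGeodesicSegment R x z →
    ∀ x' y' z' : EuclideanSpace ℝ (Fin 2),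
      dist x' y' = dist x y → dist y' z' = dist y z → dist x' z' = dist x z →
    ∀ p ∈ S, ∀ q ∈ R, ∀ p' ∈ segment ℝ x' y', ∀ q' ∈ segment ℝ x' z',
      dist x' p' = dist x p → dist x' q' = dist x q → dist p q ≤ dist p' q'

/-- Hadamard spaces: complete CAT(0) spaces. -/
structure IsHadamard (X : Type*) [MetricSpace X] : Prop where
  complete : CompleteSpace X
  catZero : IsCATZero X

/-- `z = l x ⊕ (1 - l) y`: the point `z` of a geodesic segment joining `x` to `y` with
`d(z,x) = (1 - l) d(x,y)` and `d(z,y) = l d(x,y)`. -/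
def IsOplus (l : ℝ) (x y z : X) : Prop :=
  (∃ S : Set X, IsGeodesicSegment S x y ∧ z ∈ S) ∧
    dist z x = (1 - l) * dist x y ∧ dist z y = l * dist x y

/-- In a CAT(0) space the point `l x ⊕ (1 - l) y` exists and is unique. -/
theorem IsCATZero.existsUnique_isOplus (hX : IsCATZero X) {l : ℝ} (h0 : 0 ≤ l) (h1 : l ≤ 1)
    (x y : X) : ∃! z, IsOplus l x y z := by
  obtain ⟨S, hS⟩ := hX.geodesic x y
  have hS' := hS
  obtain ⟨γ, g0, g1, hγ, rfl⟩ := hS'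
  have hd : 0 ≤ dist x y := dist_nonneg
  have hm : (1 - l) * dist x y ∈ Set.Icc 0 (dist x y) := by
    constructor <;> nlinarith
  refine ⟨γ ((1 - l) * dist x y), ⟨⟨_, hS, _, hm, rfl⟩, ?_, ?_⟩, ?_⟩
  · have := hγ _ hm 0 ⟨le_rfl, hd⟩
    rw [g0, sub_zero, abs_of_nonneg hm.1] at this
    exact this
  · have := hγ _ hm _ ⟨hd, le_rfl⟩
    rw [g1, abs_of_nonpos (by linarith [hm.2])] at this
    rw [this]; ring
  · rintro w ⟨⟨R, hR, hw⟩, hwx, -⟩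
    have hp := hγ 0 ⟨le_rfl, hd⟩ _ hm
    rw [g0, zero_sub, abs_neg, abs_of_nonneg hm.1] at hp
    have hn : ‖(EuclideanSpace.single 0 (dist x y) : EuclideanSpace ℝ (Fin 2))‖ = dist x y := by
      simp
    have hc : dist (0 : EuclideanSpace ℝ (Fin 2))
        ((1 - l) • EuclideanSpace.single 0 (dist x y)) = (1 - l) * dist x y := by
      rw [dist_zero_left, norm_smul, hn, Real.norm_of_nonneg (by linarith)]
    have hseg : (1 - l) • (EuclideanSpace.single 0 (dist x y) : EuclideanSpace ℝ (Fin 2)) ∈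
        segment ℝ 0 (EuclideanSpace.single 0 (dist x y)) :=
      ⟨l, 1 - l, h0, by linarith, by ring, by simp⟩
    have := hX.thin x y y R _ hR hS 0 (EuclideanSpace.single 0 (dist x y))
      (EuclideanSpace.single 0 (dist x y)) (by rw [dist_zero_left, hn]) (by simp)
      (by rw [dist_zero_left, hn]) w hw _ ⟨_, hm, rfl⟩ _ hseg _ hseg
      (by rw [hc, dist_comm x w, hwx]) (by rw [hc, hp])
    rw [dist_self] at this
    exact dist_le_zero.1 this

/-- Geodesic convexity: `C` contains every geodesic segment between its points. -/
def IsConvex (C : Set X) : Prop :=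
  ∀ x ∈ C, ∀ y ∈ C, ∀ S : Set X, IsGeodesicSegment S x y → S ⊆ C

/-- `u = P_C x`: `u` is a point of `C` nearest to `x`. -/
def IsProj (C : Set X) (x u : X) : Prop :=
  u ∈ C ∧ ∀ y ∈ C, dist x u ≤ dist x y

/-- The fixed point set of the self-mapping `T` of `C`. -/
def fixedPts (C : Set X) (T : X → X) : Set X := {p ∈ C | T p = p}

/-- The implicit scheme `x m = P_C (α m u m ⊕ (1 - α m) T (x m))`. -/
def IsImplicitScheme (C : Set X) (T : X → X) (α : ℕ → ℝ) (u x : ℕ → X) : Prop :=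
  ∀ m, ∃ y, IsOplus (α m) (u m) (T (x m)) y ∧ IsProj C y (x m)

/-- The explicit scheme `x 0 ∈ C`, `y n = α n u n ⊕ (1 - α n) T (x n)`,
`x (n + 1) = (1 - β n) x n ⊕ β n P_C (y n)`. -/
def IsExplicitScheme (C : Set X) (T : X → X) (α β : ℕ → ℝ) (u y x : ℕ → X) : Prop :=
  x 0 ∈ C ∧
  (∀ n, IsOplus (α n) (u n) (T (x n)) (y n)) ∧
  ∀ n, ∃ z, IsProj C (y n) z ∧ IsOplus (1 - β n) (x n) z (x (n + 1))

end CATZero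

/-!
Both schemes converge to the point `q` of the fixed point set `F(T)` nearest to `o`.

The geometry of the space enters through three consequences of comparison with Euclidean
triangles: the Bruhat–Tits inequality `IsCATZero.sq_dist_le`, the convexity of the metric
`IsCATZero.dist_oplus_le`, and the quadrilateral inequality `IsCATZero.sq_dist_add_sq_dist_le`.
They give the existence of minimizers of strongly convex functions
(`IsHadamard.exists_minimizer`), and with it the projections, their variational inequality and
their nonexpansiveness.

By convexity of the metric, replacing the anchors `u n` by the constant `o` changes the implicit
scheme by at most `dist (u n) o`, and the explicit scheme by a quantity governed by
`s (n + 1) ≤ (1 - α n β n) s n + α n dist (u n) o`, which tends to zero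
(`tendsto_zero_of_le_one_sub_mul_add`). So both anchors may be taken to be `o`.

The Bruhat–Tits inequality at the fixed point `q` then bounds the squared distance to `q` by
means of the quantity `b n = dist o q ^ 2 - (1 - α n) * dist o (T (x n)) ^ 2`: it is at most `b n`
for the implicit scheme, and it is contracted towards `b n` by the explicit scheme. Along bounded
approximate fixed points `b n` is asymptotically nonpositive, by an asymptotic center argument
along ultrafilters (`IsHadamard.eventually_sq_dist_lt`) that replaces weak compactness. The
implicit scheme consists of approximate fixed points. For the explicit scheme, strong convexity
provides an additional term `- β n * (1 - β n) * dist (x n) (P_C (y n)) ^ 2`; when this term is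
too small to absorb `α n β n b n`, the point `x n` is an approximate fixed point and `b n` is
small anyway.
-/

namespace CATZero

variable {X : Type*} [MetricSpace X]

/-! ### Comparison inequalities -/

/-- Three nonnegative reals satisfying the triangle inequalities are the side lengths of a
triangle in the Euclidean plane; here they are the distances of three points of `X`. -/
theorem exists_comparison_triangle (x y z : X) : ∃ x' y' z' : EuclideanSpace ℝ (Fin 2),
    dist x' y' = dist x y ∧ dist y' z' = dist y z ∧ dist x' z' = dist x z := by
  have key : ∀ a b c : ℝ, 0 ≤ a → 0 ≤ b → 0 ≤ c → a ≤ b + c → b ≤ a + c → c ≤ a + b →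
      ∃ s t : ℝ, s ^ 2 + t ^ 2 = b ^ 2 ∧ (a - s) ^ 2 + t ^ 2 = c ^ 2 := by
    intro a b c ha hb hc h1 h2 h3
    rcases ha.eq_or_lt with rfl | ha
    · exact ⟨0, b, by ring, by rw [le_antisymm (by linarith : b ≤ c) (by linarith)]; ring⟩
    · have hs : (a ^ 2 + b ^ 2 - c ^ 2) / (2 * a) * (2 * a) = a ^ 2 + b ^ 2 - c ^ 2 := by
        field_simp
      set s := (a ^ 2 + b ^ 2 - c ^ 2) / (2 * a)
      have hsb : s ≤ b := by
        by_contra! h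
        nlinarith [mul_lt_mul_of_pos_right h (by linarith : 0 < 2 * a)]
      have hsb' : -b ≤ s := by
        by_contra! h
        nlinarith [mul_lt_mul_of_pos_right h (by linarith : 0 < 2 * a)]
      have ht : √(b ^ 2 - s ^ 2) ^ 2 = b ^ 2 - s ^ 2 := Real.sq_sqrt (by nlinarith)
      exact ⟨s, √(b ^ 2 - s ^ 2), by rw [ht]; ring, by rw [ht]; linarith [hs]⟩
  obtain ⟨s, t, h1, h2⟩ := key (dist x y) (dist x z) (dist y z) dist_nonneg dist_nonneg
    dist_nonneg (by linarith [dist_triangle x z y, dist_comm y z]) (dist_triangle x y z)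
    (by linarith [dist_triangle y x z, dist_comm x y])
  refine ⟨!₂[0, 0], !₂[dist x y, 0], !₂[s, t], ?_, ?_, ?_⟩
  · simp [EuclideanSpace.dist_eq, Fin.sum_univ_two, Real.dist_eq, Real.sqrt_sq dist_nonneg]
  · rw [← Real.sqrt_sq (dist_nonneg (x := y) (y := z)), ← h2]
    simp [EuclideanSpace.dist_eq, Fin.sum_univ_two, Real.dist_eq]
  · rw [← Real.sqrt_sq (dist_nonneg (x := x) (y := z)), ← h1]
    simp [EuclideanSpace.dist_eq, Fin.sum_univ_two, Real.dist_eq]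

theorem IsGeodesicSegment.symm {S : Set X} {x y : X} (h : IsGeodesicSegment S x y) :
    IsGeodesicSegment S y x := by
  obtain ⟨γ, g0, g1, hγ, rfl⟩ := h
  refine ⟨fun t => γ (dist x y - t), by simpa using g1, by simpa [dist_comm y x] using g0, ?_, ?_⟩
  · rw [dist_comm y x]
    rintro s ⟨hs, hs'⟩ t ⟨ht, ht'⟩
    rw [hγ _ ⟨by linarith, by linarith⟩ _ ⟨by linarith, by linarith⟩, abs_sub_comm]
    congr 1; ring
  · rw [dist_comm y x]
    ext p
    constructor
    · rintro ⟨t, ⟨ht, ht'⟩, rfl⟩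
      exact ⟨dist x y - t, ⟨by linarith, by linarith⟩, by simp⟩
    · rintro ⟨t, ⟨ht, ht'⟩, rfl⟩
      exact ⟨dist x y - t, ⟨by linarith, by linarith⟩, rfl⟩

theorem IsGeodesicSegment.right_mem {S : Set X} {x y : X} (h : IsGeodesicSegment S x y) :
    y ∈ S := by
  obtain ⟨γ, -, g1, -, rfl⟩ := h
  exact ⟨_, ⟨dist_nonneg, le_rfl⟩, g1⟩

theorem IsOplus.symm {l : ℝ} {x y z : X} (h : IsOplus l x y z) : IsOplus (1 - l) y x z := by
  obtain ⟨⟨S, hS, hz⟩, h1, h2⟩ := h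
  exact ⟨⟨S, hS.symm, hz⟩, by rw [h2, dist_comm x y]; ring, by rw [h1, dist_comm x y]⟩

theorem isOplus_self {l : ℝ} (x : X) : IsOplus l x x x :=
  ⟨⟨{x}, ⟨fun _ => x, rfl, rfl, by simp, by simp⟩, rfl⟩, by simp, by simp⟩

/-- The Bruhat–Tits inequality: `z ↦ dist p z ^ 2` is at least as convex along geodesics as in
Euclidean space. -/
theorem IsCATZero.sq_dist_le (hX : IsCATZero X) {l : ℝ} (h0 : 0 ≤ l) (h1 : l ≤ 1) {x y z : X}
    (hz : IsOplus l x y z) (p : X) :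
    dist p z ^ 2 ≤ l * dist p x ^ 2 + (1 - l) * dist p y ^ 2 - l * (1 - l) * dist x y ^ 2 := by
  obtain ⟨⟨S, hS, hzS⟩, hzx, -⟩ := hz
  obtain ⟨R, hR⟩ := hX.geodesic x p
  obtain ⟨x', y', p', hxy, hyp, hxp⟩ := exists_comparison_triangle x y p
  have hd : dist x' (l • x' + (1 - l) • y') = (1 - l) * dist x y := by
    rw [← hxy, dist_eq_norm, dist_eq_norm,
      show x' - (l • x' + (1 - l) • y') = (1 - l) • (x' - y') by module, norm_smul,
      Real.norm_of_nonneg (by linarith)]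
  have := hX.thin x y p S R hS hR x' y' p' hxy hyp hxp z hzS p hR.right_mem
    (l • x' + (1 - l) • y') ⟨l, 1 - l, h0, by linarith, by ring, rfl⟩ p' (right_mem_segment ..)
    (by rw [hd, dist_comm x z, hzx]) hxp
  have hE : dist (l • x' + (1 - l) • y') p' ^ 2 =
      l * dist x' p' ^ 2 + (1 - l) * dist y' p' ^ 2 - l * (1 - l) * dist x' y' ^ 2 := by
    simp only [dist_eq_norm]
    rw [show l • x' + (1 - l) • y' - p' = l • (x' - p') + (1 - l) • (y' - p') by module,
      show x' - y' = (x' - p') - (y' - p') by abel]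
    simp only [norm_add_sq_real, norm_sub_sq_real, norm_smul, inner_smul_left, inner_smul_right,
      mul_pow, Real.norm_eq_abs, sq_abs, RCLike.conj_to_real]
    ring
  rw [hxp, hyp, hxy] at hE
  rw [dist_comm p z, dist_comm p x, dist_comm p y, ← hE]
  gcongr

/-- Convexity of the metric for two geodesics issuing from the same point. -/
theorem IsCATZero.dist_oplus_left_le (hX : IsCATZero X) {l : ℝ} (h0 : 0 ≤ l) (h1 : l ≤ 1)
    {x y y' z z' : X} (hz : IsOplus l x y z) (hz' : IsOplus l x y' z') :
    dist z z' ≤ (1 - l) * dist y y' := by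
  obtain ⟨⟨S, hS, hzS⟩, hzx, -⟩ := hz
  obtain ⟨R, hR, hzR⟩ := hz'.1
  obtain ⟨a, b, c, hab, hbc, hac⟩ := exists_comparison_triangle x y y'
  have hd : ∀ b, dist a (l • a + (1 - l) • b) = (1 - l) * dist a b := fun b => by
    rw [dist_eq_norm, dist_eq_norm, show a - (l • a + (1 - l) • b) = (1 - l) • (a - b) by module,
      norm_smul, Real.norm_of_nonneg (by linarith)]
  have := hX.thin x y y' S R hS hR a b c hab hbc hac z hzS z' hzR
    (l • a + (1 - l) • b) ⟨l, 1 - l, h0, by linarith, by ring, rfl⟩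
    (l • a + (1 - l) • c) ⟨l, 1 - l, h0, by linarith, by ring, rfl⟩
    (by rw [hd, hab, dist_comm x z, hzx]) (by rw [hd, hac, dist_comm x z', hz'.2.1])
  rwa [dist_eq_norm, show l • a + (1 - l) • b - (l • a + (1 - l) • c) = (1 - l) • (b - c) by
    module, norm_smul, Real.norm_of_nonneg (by linarith), ← dist_eq_norm, hbc] at this

/-- Joint convexity of the metric. -/
theorem IsCATZero.dist_oplus_le (hX : IsCATZero X) {l : ℝ} (h0 : 0 ≤ l) (h1 : l ≤ 1)
    {x y x' y' z z' : X} (hz : IsOplus l x y z) (hz' : IsOplus l x' y' z') :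
    dist z z' ≤ l * dist x x' + (1 - l) * dist y y' := by
  obtain ⟨w, hw, -⟩ := hX.existsUnique_isOplus h0 h1 x y'
  have h2 := hX.dist_oplus_left_le h0 h1 hz hw
  have h3 := hX.dist_oplus_left_le (by linarith) (by linarith) hw.symm hz'.symm
  linarith [dist_triangle z w z']

/-- The quadrilateral inequality: the squares of the diagonals of a quadrilateral are bounded
by the squares of its four sides. -/
theorem IsCATZero.sq_dist_add_sq_dist_le (hX : IsCATZero X) (a b c d : X) :
    dist a c ^ 2 + dist b d ^ 2 ≤
      dist a b ^ 2 + dist b c ^ 2 + dist c d ^ 2 + dist d a ^ 2 := by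
  obtain ⟨m, hm, -⟩ := hX.existsUnique_isOplus (l := 1 / 2) (by norm_num) (by norm_num) a c
  have h1 := hX.sq_dist_le (by norm_num) (by norm_num) hm b
  have h2 := hX.sq_dist_le (by norm_num) (by norm_num) hm d
  have h3 : dist b d ^ 2 ≤ (dist b m + dist d m) ^ 2 := by
    gcongr
    exact dist_triangle_right b d m
  rw [dist_comm b a] at h1
  rw [dist_comm d c] at h2
  nlinarith [sq_nonneg (dist b m - dist d m)]

/-! ### Minimizers of strongly convex functions and metric projections -/

/-- The uniform convexity of squared distances: along a geodesic, `φ` is at least as convex as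
the square of the distance to a point of Euclidean space. -/
def IsStronglyConvex (φ : X → ℝ) : Prop :=
  ∀ l ∈ Set.Icc (0 : ℝ) 1, ∀ x y z : X, IsOplus l x y z →
    φ z ≤ l * φ x + (1 - l) * φ y - l * (1 - l) * dist x y ^ 2

/-- A continuous strongly convex function that is bounded below attains its minimum on a nonempty
closed convex set, with quadratic growth away from the minimizer. Convexity of the set is assumed
in the form of stability under `IsOplus`. -/
theorem IsHadamard.exists_minimizer (hX : IsHadamard X) {C : Set X} (hne : C.Nonempty)
    (hcl : IsClosed C)
    (hC : ∀ l ∈ Set.Icc (0 : ℝ) 1, ∀ x ∈ C, ∀ y ∈ C, ∀ z, IsOplus l x y z → z ∈ C)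
    {φ : X → ℝ} (hφ : IsStronglyConvex φ) (hcont : Continuous φ) (h0 : ∀ x, 0 ≤ φ x) :
    ∃ v ∈ C, ∀ w ∈ C, φ v + dist v w ^ 2 ≤ φ w := by
  have := hX.complete
  set m := sInf (φ '' C)
  have hbdd : BddBelow (φ '' C) := ⟨0, by rintro _ ⟨x, -, rfl⟩; exact h0 x⟩
  have hm : ∀ x ∈ C, m ≤ φ x := fun x hx => csInf_le hbdd ⟨x, hx, rfl⟩
  have hex : ∀ n : ℕ, ∃ x ∈ C, φ x < m + 1 / ((n : ℝ) + 1) := fun n => by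
    obtain ⟨_, ⟨x, hx, rfl⟩, h⟩ := exists_lt_of_csInf_lt (hne.image φ)
      (lt_add_of_pos_right m (Nat.one_div_pos_of_nat (n := n) (α := ℝ)))
    exact ⟨x, hx, h⟩
  choose x hxC hx using hex
  have hlim : Tendsto (fun n : ℕ => 1 / ((n : ℝ) + 1)) atTop (𝓝 0) :=
    tendsto_one_div_add_atTop_nhds_zero_nat
  -- Comparing with the midpoint bounds the distance between two almost minimizers.
  have hmid : ∀ a ∈ C, ∀ b ∈ C, dist a b ^ 2 ≤ 2 * (φ a - m) + 2 * (φ b - m) := by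
    intro a ha b hb
    obtain ⟨z, hz, -⟩ := hX.catZero.existsUnique_isOplus (l := 1 / 2) (by norm_num)
      (by norm_num) a b
    have h1 := hφ _ ⟨by norm_num, by norm_num⟩ a b z hz
    have h2 := hm z (hC _ ⟨by norm_num, by norm_num⟩ a ha b hb z hz)
    linarith
  have hcau : CauchySeq x := by
    refine cauchySeq_of_le_tendsto_0 (fun n : ℕ => √(4 * (1 / ((n : ℝ) + 1)))) ?_ ?_
    · intro n k N hn hk
      refine Real.le_sqrt_of_sq_le ((hmid _ (hxC n) _ (hxC k)).trans ?_)
      have hn' := Nat.one_div_le_one_div (α := ℝ) hn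
      have hk' := Nat.one_div_le_one_div (α := ℝ) hk
      linarith [hx n, hx k]
    · simpa using (hlim.const_mul 4).sqrt
  obtain ⟨v, hv⟩ := cauchySeq_tendsto_of_complete hcau
  have hvC : v ∈ C := hcl.mem_of_tendsto hv (Eventually.of_forall hxC)
  have hvm : φ v ≤ m := by
    refine le_of_tendsto_of_tendsto' ((hcont.tendsto v).comp hv) ?_ (fun n => (hx n).le)
    simpa using hlim.const_add m
  refine ⟨v, hvC, fun w hw => ?_⟩
  have hlow : ∀ t ∈ Set.Ioo (0 : ℝ) 1, φ v + (1 - t) * dist v w ^ 2 ≤ φ w := by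
    rintro t ⟨ht0, ht1⟩
    obtain ⟨z, hz, -⟩ := hX.catZero.existsUnique_isOplus ht0.le ht1.le w v
    have h1 := hφ t ⟨ht0.le, ht1.le⟩ w v z hz
    have h2 := hm z (hC t ⟨ht0.le, ht1.le⟩ w hw v hvC z hz)
    rw [dist_comm w v] at h1
    nlinarith
  have ht : Tendsto (fun t : ℝ => φ v + (1 - t) * dist v w ^ 2) (𝓝[>] 0)
      (𝓝 (φ v + (1 - 0) * dist v w ^ 2)) :=
    (Continuous.tendsto (by fun_prop) 0).mono_left nhdsWithin_le_nhds
  have := le_of_tendsto ht (eventually_of_mem (Ioo_mem_nhdsGT one_pos) hlow)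
  simpa using this

theorem IsCATZero.isStronglyConvex_sq_dist (hX : IsCATZero X) (p : X) :
    IsStronglyConvex (fun x => dist p x ^ 2) :=
  fun _ hl _ _ _ hz => hX.sq_dist_le hl.1 hl.2 hz p

theorem IsConvex.oplus_mem {C : Set X} (hC : IsConvex C) :
    ∀ l ∈ Set.Icc (0 : ℝ) 1, ∀ x ∈ C, ∀ y ∈ C, ∀ z, IsOplus l x y z → z ∈ C := by
  rintro l - x hx y hy z ⟨⟨S, hS, hz⟩, -⟩
  exact hC x hx y hy S hS hz

theorem IsHadamard.exists_isProj (hX : IsHadamard X) {C : Set X} (hne : C.Nonempty)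
    (hcl : IsClosed C)
    (hC : ∀ l ∈ Set.Icc (0 : ℝ) 1, ∀ x ∈ C, ∀ y ∈ C, ∀ z, IsOplus l x y z → z ∈ C) (x : X) :
    ∃ p, IsProj C x p := by
  obtain ⟨v, hv, h⟩ := hX.exists_minimizer hne hcl hC (hX.catZero.isStronglyConvex_sq_dist x)
    (by fun_prop) (fun _ => by positivity)
  refine ⟨v, hv, fun w hw => ?_⟩
  have := h w hw
  exact abs_le_of_sq_le_sq' (by nlinarith [sq_nonneg (dist v w)]) dist_nonneg |>.2

/-- The variational inequality: the angle at the projection `p` of `x` towards any point `w`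
of `C` is obtuse. -/
theorem IsHadamard.sq_dist_add_sq_dist_le_of_isProj (hX : IsHadamard X) {C : Set X}
    (hcl : IsClosed C) (hC : IsConvex C) {x p w : X} (hp : IsProj C x p) (hw : w ∈ C) :
    dist x p ^ 2 + dist p w ^ 2 ≤ dist x w ^ 2 := by
  obtain ⟨v, hv, h⟩ := hX.exists_minimizer ⟨p, hp.1⟩ hcl hC.oplus_mem
    (hX.catZero.isStronglyConvex_sq_dist x) (by fun_prop) (fun _ => by positivity)
  have h1 := h p hp.1
  have h2 : dist x p ^ 2 ≤ dist x v ^ 2 := by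
    gcongr
    exact hp.2 v hv
  have h3 : v = p := dist_eq_zero.1 (pow_eq_zero_iff two_ne_zero |>.1 (by
    nlinarith [sq_nonneg (dist v p)]))
  subst h3
  exact h w hw

/-- Metric projections are nonexpansive. -/
theorem IsHadamard.dist_proj_le (hX : IsHadamard X) {C : Set X} (hcl : IsClosed C)
    (hC : IsConvex C) {x y p q : X} (hp : IsProj C x p) (hq : IsProj C y q) :
    dist p q ≤ dist x y := by
  have h1 := hX.sq_dist_add_sq_dist_le_of_isProj hcl hC hp hq.1
  have h2 := hX.sq_dist_add_sq_dist_le_of_isProj hcl hC hq hp.1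
  have h3 := hX.catZero.sq_dist_add_sq_dist_le x y q p
  have e1 := dist_comm p q
  have e2 := dist_comm x p
  have e3 := dist_comm y p
  refine abs_le_of_sq_le_sq' ?_ dist_nonneg |>.2
  simp only [e1, e2, e3] at *
  nlinarith

theorem isProj_self {C : Set X} {x : X} (hx : x ∈ C) : IsProj C x x :=
  ⟨hx, fun y _ => by simp⟩

/-! ### Approximate fixed points of nonexpansive mappings -/

theorem isClosed_fixedPts {C : Set X} (hcl : IsClosed C) {T : X → X}
    (hT : ∀ a ∈ C, ∀ b ∈ C, dist (T a) (T b) ≤ dist a b) : IsClosed (fixedPts C T) := by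
  have hcont : ContinuousOn T C :=
    (LipschitzOnWith.of_dist_le_mul (K := 1) fun a ha b hb => by
      simpa using hT a ha b hb).continuousOn
  refine isClosed_of_closure_subset fun x hx => ?_
  have hxC : x ∈ C := closure_minimal (fun _ h => h.1) hcl hx
  have : (𝓝[fixedPts C T] x).NeBot := mem_closure_iff_nhdsWithin_neBot.1 hx
  have h1 : Tendsto T (𝓝[fixedPts C T] x) (𝓝 (T x)) :=
    (hcont x hxC).mono_left (nhdsWithin_mono x fun _ h => h.1)
  have h2 : Tendsto T (𝓝[fixedPts C T] x) (𝓝 x) := by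
    refine (tendsto_id'.2 nhdsWithin_le_nhds).congr' ?_
    filter_upwards [self_mem_nhdsWithin] with y hy using hy.2.symm
  exact ⟨hxC, tendsto_nhds_unique h1 h2⟩

theorem IsCATZero.oplus_mem_fixedPts (hX : IsCATZero X) {C : Set X} (hC : IsConvex C) {T : X → X}
    (hT : ∀ a ∈ C, ∀ b ∈ C, dist (T a) (T b) ≤ dist a b) :
    ∀ l ∈ Set.Icc (0 : ℝ) 1, ∀ x ∈ fixedPts C T, ∀ y ∈ fixedPts C T, ∀ z, IsOplus l x y z →
      z ∈ fixedPts C T := by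
  rintro l ⟨h0, h1⟩ x hx y hy z hz
  have hzC := hC.oplus_mem l ⟨h0, h1⟩ x hx.1 y hy.1 z hz
  have h2 := hX.sq_dist_le h0 h1 hz (T z)
  have hx' := hT z hzC x hx.1
  have hy' := hT z hzC y hy.1
  rw [hx.2, hz.2.1] at hx'
  rw [hy.2, hz.2.2] at hy'
  have hx2 : l * dist (T z) x ^ 2 ≤ l * ((1 - l) * dist x y) ^ 2 := by gcongr
  have hy2 : (1 - l) * dist (T z) y ^ 2 ≤ (1 - l) * (l * dist x y) ^ 2 := by
    have : 0 ≤ 1 - l := by linarith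
    gcongr
  have h3 : dist (T z) z ^ 2 ≤ 0 := by nlinarith
  exact ⟨hzC, dist_eq_zero.1 (pow_eq_zero_iff two_ne_zero |>.1 (le_antisymm h3 (sq_nonneg _)))⟩

/-- Bounded approximate fixed points of `T` are asymptotically at least as far from `o` as the
fixed point set is. Along an ultrafilter, the asymptotic center `v` of the family is a fixed
point, and strong convexity on `[o, v]` bounds `dist v o` by the limit of the distances to `o`. -/
theorem IsHadamard.eventually_sq_dist_lt (hX : IsHadamard X) {C : Set X} (hcl : IsClosed C)
    (hC : IsConvex C) {T : X → X}
    (hT : ∀ a ∈ C, ∀ b ∈ C, dist (T a) (T b) ≤ dist a b) {o q : X}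
    (hq : IsProj (fixedPts C T) o q) {ι : Type*} {l : Filter ι} {z : ι → X} {R : ℝ}
    (hzC : ∀ i, z i ∈ C) (hR : ∀ i, dist o (z i) ≤ R)
    (hz : Tendsto (fun i => dist (z i) (T (z i))) l (𝓝 0)) {ε : ℝ} (hε : 0 < ε) :
    ∀ᶠ i in l, dist o q ^ 2 - ε < dist o (z i) ^ 2 := by
  refine mem_iff_ultrafilter.2 fun U hU => ?_
  have hex : ∀ x, ∃ a, Tendsto (fun i => dist x (z i)) U (𝓝 a) := by
    intro x
    have hmem : Set.Icc 0 (dist x o + R) ∈ U.map (fun i => dist x (z i)) :=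
      mem_map.2 (univ_mem' fun i =>
        ⟨dist_nonneg, (dist_triangle x o (z i)).trans (by linarith [hR i])⟩)
    obtain ⟨a, -, ha⟩ := isCompact_Icc.ultrafilter_le_nhds' _ hmem
    exact ⟨a, ha⟩
  choose ψ hψ using hex
  have hψ0 : ∀ x, 0 ≤ ψ x := fun x => ge_of_tendsto' (hψ x) fun i => dist_nonneg
  have hcont : Continuous ψ := by
    refine (LipschitzWith.of_le_add fun x y => ?_).continuous
    refine le_of_tendsto_of_tendsto' (hψ x) ((hψ y).add_const (dist x y)) fun i => ?_
    linarith [dist_triangle x y (z i)]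
  have hsc : IsStronglyConvex fun x => ψ x ^ 2 := by
    intro t ht x y w hw
    refine le_of_tendsto_of_tendsto' ((hψ w).pow 2)
      (((((hψ x).pow 2).const_mul t).add (((hψ y).pow 2).const_mul (1 - t))).sub_const
        (t * (1 - t) * dist x y ^ 2)) fun i => ?_
    simpa only [dist_comm (z i)] using hX.catZero.sq_dist_le ht.1 ht.2 hw (z i)
  obtain ⟨v, -, hv⟩ := hX.exists_minimizer ⟨o, Set.mem_univ o⟩ isClosed_univ
    (fun _ _ _ _ _ _ _ _ => Set.mem_univ _) hsc (hcont.pow 2) (fun x => sq_nonneg _)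
  have huniq : ∀ w, ψ w ≤ ψ v → v = w := by
    intro w hw
    have h1 := hv w (Set.mem_univ w)
    have h2 : ψ w ^ 2 ≤ ψ v ^ 2 := by
      have := hψ0 w
      gcongr
    exact dist_eq_zero.1 (pow_eq_zero_iff two_ne_zero |>.1 (by nlinarith [sq_nonneg (dist v w)]))
  have hneC : C.Nonempty := ⟨q, hq.1.1⟩
  have hvC : v ∈ C := by
    obtain ⟨c, hc⟩ := hX.exists_isProj hneC hcl hC.oplus_mem v
    have : v = c := huniq c (le_of_tendsto_of_tendsto' (hψ c) (hψ v) fun i =>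
      hX.dist_proj_le hcl hC hc (isProj_self (hzC i)))
    exact this ▸ hc.1
  have hvF : T v = v := by
    refine (huniq (T v) ?_).symm
    refine le_of_tendsto_of_tendsto' (hψ (T v)) (by simpa using (hψ v).add (hz.mono_left hU))
      fun i => ?_
    have h1 := dist_triangle (T v) (T (z i)) (z i)
    have h2 := hT v hvC (z i) (hzC i)
    rw [dist_comm (z i)]
    linarith
  have h1 : dist o q ^ 2 ≤ ψ o ^ 2 := by
    have h2 : dist o q ^ 2 ≤ dist o v ^ 2 := by
      gcongr
      exact hq.2 v ⟨hvC, hvF⟩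
    have h3 := hv o (Set.mem_univ o)
    rw [dist_comm v o] at h3
    nlinarith [sq_nonneg (ψ v)]
  exact ((hψ o).pow 2).eventually (lt_mem_nhds (by linarith))

/-! ### Real sequences contracted by a divergent series -/

theorem tendsto_zero_of_le_one_sub_mul_add {s a e : ℕ → ℝ} (hs : ∀ n, 0 ≤ s n)
    (ha : ∀ n, 0 ≤ a n) (ha' : ¬ Summable a) (he : ∀ n, 0 ≤ e n) (he' : Summable e)
    (h : ∀ n, s (n + 1) ≤ (1 - a n) * s n + e n) : Tendsto s atTop (𝓝 0) := by
  -- Adding the tail of the series of errors makes the sequence decreasing.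
  set r : ℕ → ℝ := fun n => ∑' k, e (k + n)
  have hr0 : ∀ n, 0 ≤ r n := fun n => tsum_nonneg fun k => he _
  have hr : ∀ n, r n = e n + r (n + 1) := fun n => by
    have := ((summable_nat_add_iff n).2 he').tsum_eq_zero_add
    simpa [r, add_assoc, add_comm, add_left_comm] using this
  have hrlim : Tendsto r atTop (𝓝 0) := tendsto_sum_nat_add e
  have hstep : ∀ n, s (n + 1) + r (n + 1) ≤ s n + r n - a n * s n := fun n => by
    linarith [h n, hr n]
  have hanti : Antitone fun n => s n + r n := antitone_nat_of_succ_le fun n => by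
    linarith [hstep n, mul_nonneg (ha n) (hs n)]
  have hsum : Summable fun n => a n * s n := by
    refine summable_of_sum_range_le (c := s 0 + r 0) (fun n => mul_nonneg (ha n) (hs n)) ?_
    have : ∀ N, ∑ n ∈ Finset.range N, a n * s n ≤ s 0 + r 0 - (s N + r N) := by
      intro N
      induction N with
      | zero => simp
      | succ N ih => rw [Finset.sum_range_succ]; linarith [hstep N]
    exact fun N => (this N).trans (by linarith [hs N, hr0 N])
  have hL := tendsto_atTop_ciInf hanti ⟨0, by rintro _ ⟨n, rfl⟩; exact add_nonneg (hs n) (hr0 n)⟩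
  set L := ⨅ n, s n + r n
  have hsL : Tendsto s atTop (𝓝 L) := by simpa using hL.sub hrlim
  rcases (ge_of_tendsto' hsL hs).eq_or_lt with h0 | h0
  · rwa [h0]
  · refine absurd ((hsum.mul_left (2 / L)).of_norm_bounded_eventually ?_) ha'
    rw [Nat.cofinite_eq_atTop]
    filter_upwards [hsL.eventually (lt_mem_nhds (half_lt_self h0))] with n hn
    rw [Real.norm_of_nonneg (ha n)]
    have : 1 ≤ 2 / L * s n := by
      rw [div_mul_eq_mul_div, le_div_iff₀ h0]; linarith
    nlinarith [ha n]

/-- The same contraction with errors of size `o(a n)` instead of summable ones. -/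
theorem tendsto_zero_of_eventually_le {s a : ℕ → ℝ} (hs : ∀ n, 0 ≤ s n) (ha : ∀ n, 0 ≤ a n)
    (ha1 : ∀ n, a n ≤ 1) (ha' : ¬ Summable a)
    (h : ∀ ε > 0, ∀ᶠ n in atTop, s (n + 1) ≤ (1 - a n) * s n + a n * ε) :
    Tendsto s atTop (𝓝 0) := by
  refine tendsto_order.2 ⟨fun b hb => Eventually.of_forall fun n => hb.trans_le (hs n),
    fun b hb => ?_⟩
  obtain ⟨N, hN⟩ := eventually_atTop.1 (h (b / 2) (by linarith))
  have hlim : Tendsto (fun n => max (s (n + N) - b / 2) 0) atTop (𝓝 0) := by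
    refine tendsto_zero_of_le_one_sub_mul_add (a := fun n => a (n + N)) (e := fun _ => 0)
      (fun n => le_max_right _ _) (fun n => ha _) (mt (summable_nat_add_iff N).1 ha')
      (fun _ => le_rfl) summable_zero fun n => ?_
    have h1 := hN (n + N) (by omega)
    have h2 : 0 ≤ 1 - a (n + N) := by linarith [ha1 (n + N)]
    have h3 := mul_le_mul_of_nonneg_left (le_max_left (s (n + N) - b / 2) 0) h2
    have h4 := mul_nonneg h2 (le_max_right (s (n + N) - b / 2) 0)
    rw [add_zero, show n + 1 + N = n + N + 1 by ring]
    exact max_le (by linarith) h4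
  have hev := hlim.eventually (gt_mem_nhds (by linarith : 0 < b / 2))
  obtain ⟨M, hM⟩ := eventually_atTop.1 hev
  filter_upwards [eventually_ge_atTop (M + N)] with n hn
  have h1 := hM (n - N) (by omega)
  rw [Nat.sub_add_cancel (by omega)] at h1
  linarith [le_max_left (s n - b / 2) 0]

/-! ### One step of the schemes -/

theorem IsHadamard.dist_proj_oplus_le (hX : IsHadamard X) {C : Set X} (hcl : IsClosed C)
    (hC : IsConvex C) {l : ℝ} (hl : l ∈ Set.Ioo (0 : ℝ) 1) {u u' t t' y y' z z' : X}
    (hy : IsOplus l u t y) (hy' : IsOplus l u' t' y') (hz : IsProj C y z) (hz' : IsProj C y' z') :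
    dist z z' ≤ l * dist u u' + (1 - l) * dist t t' :=
  (hX.dist_proj_le hcl hC hz hz').trans (hX.catZero.dist_oplus_le hl.1.le hl.2.le hy hy')

theorem IsHadamard.sq_dist_proj_oplus_le (hX : IsHadamard X) {C : Set X} (hcl : IsClosed C)
    (hC : IsConvex C) {l : ℝ} (hl : l ∈ Set.Ioo (0 : ℝ) 1) {u t y z p : X}
    (hy : IsOplus l u t y) (hz : IsProj C y z) (hp : p ∈ C) :
    dist z p ^ 2 ≤ l * dist u p ^ 2 + (1 - l) * dist t p ^ 2 - l * (1 - l) * dist u t ^ 2 := by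
  have h1 := hX.dist_proj_le hcl hC hz (isProj_self hp)
  have h2 := hX.catZero.sq_dist_le hl.1.le hl.2.le hy p
  rw [dist_comm p, dist_comm p, dist_comm p] at h2
  refine le_trans ?_ h2
  gcongr

theorem IsHadamard.dist_proj_oplus_right_le (hX : IsHadamard X) {C : Set X} (hcl : IsClosed C)
    (hC : IsConvex C) {l : ℝ} {u t y z : X} (hy : IsOplus l u t y) (hz : IsProj C y z)
    (ht : t ∈ C) : dist z t ≤ l * dist u t :=
  (hX.dist_proj_le hcl hC hz (isProj_self ht)).trans hy.2.2.le

/-- The quantity that controls both schemes is asymptotically nonpositive along bounded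
approximate fixed points. -/
theorem IsHadamard.eventually_sq_dist_sub_le (hX : IsHadamard X) {C : Set X} (hcl : IsClosed C)
    (hC : IsConvex C) {T : X → X} (hTC : Set.MapsTo T C C)
    (hT : ∀ a ∈ C, ∀ b ∈ C, dist (T a) (T b) ≤ dist a b) {o q : X}
    (hq : IsProj (fixedPts C T) o q) {ι : Type*} {l : Filter ι} {z : ι → X} {R : ℝ}
    (hzC : ∀ i, z i ∈ C) (hR : ∀ i, dist o (T (z i)) ≤ R)
    (hz : Tendsto (fun i => dist (z i) (T (z i))) l (𝓝 0)) {α : ι → ℝ} (hα : ∀ i, 0 ≤ α i)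
    (hα0 : Tendsto α l (𝓝 0)) {ε : ℝ} (hε : 0 < ε) :
    ∀ᶠ i in l, dist o q ^ 2 - (1 - α i) * dist o (T (z i)) ^ 2 ≤ ε := by
  have h1 := hX.eventually_sq_dist_lt hcl hC hT hq (z := fun i => T (z i))
    (fun i => hTC (hzC i)) hR
    (squeeze_zero (fun _ => dist_nonneg) (fun i => hT _ (hzC i) _ (hTC (hzC i))) hz) (half_pos hε)
  have h2 : Tendsto (fun i => α i * R ^ 2) l (𝓝 0) := by simpa using hα0.mul_const (R ^ 2)
  filter_upwards [h1, h2.eventually (gt_mem_nhds (half_pos hε))] with i h1 h2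
  have h3 : α i * dist o (T (z i)) ^ 2 ≤ α i * R ^ 2 := by
    have := hα i
    have := hR i
    gcongr
  linarith

/-! ### The implicit scheme -/

/-- `x ↦ P_C (l u ⊕ (1 - l) T x)` is a contraction of `C` with constant `1 - l`, so that it has
a fixed point. -/
theorem IsHadamard.exists_implicit (hX : IsHadamard X) {C : Set X} (hne : C.Nonempty)
    (hcl : IsClosed C) (hC : IsConvex C) {T : X → X}
    (hT : ∀ a ∈ C, ∀ b ∈ C, dist (T a) (T b) ≤ dist a b) {l : ℝ} (hl : l ∈ Set.Ioo (0 : ℝ) 1)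
    (u : X) : ∃ x y, IsOplus l u (T x) y ∧ IsProj C y x := by
  have := hX.complete
  choose P hP using hX.exists_isProj hne hcl hC.oplus_mem
  choose m hm _ using fun x => hX.catZero.existsUnique_isOplus hl.1.le hl.2.le u (T x)
  have hmaps : Set.MapsTo (fun x => P (m x)) C C := fun x _ => (hP (m x)).1
  have hcontr : ContractingWith (1 - l).toNNReal (hmaps.restrict (fun x => P (m x)) C C) := by
    refine ⟨by simpa using hl.1, LipschitzWith.of_dist_le_mul fun a b => ?_⟩
    rw [Real.coe_toNNReal _ (by linarith [hl.2])]
    refine (hX.dist_proj_oplus_le hcl hC hl (hm a) (hm b) (hP _) (hP _)).trans ?_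
    rw [dist_self, mul_zero, zero_add]
    exact mul_le_mul_of_nonneg_left (hT a a.2 b b.2) (by linarith [hl.2])
  obtain ⟨x₀, hx₀⟩ := hne
  obtain ⟨x, -, hx, -⟩ := hcontr.exists_fixedPoint' hcl.isComplete hmaps hx₀ (edist_ne_top _ _)
  refine ⟨x, m x, hm x, ?_⟩
  have := hP (m x)
  rwa [show P (m x) = x from hx] at this

/-- Solutions of the implicit equation depend on the anchor `u` in a nonexpansive way. -/
theorem IsHadamard.dist_implicit_le (hX : IsHadamard X) {C : Set X} (hcl : IsClosed C)
    (hC : IsConvex C) {T : X → X} (hT : ∀ a ∈ C, ∀ b ∈ C, dist (T a) (T b) ≤ dist a b)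
    {l : ℝ} (hl : l ∈ Set.Ioo (0 : ℝ) 1) {u u' x x' y y' : X}
    (hy : IsOplus l u (T x) y) (hx : IsProj C y x) (hy' : IsOplus l u' (T x') y')
    (hx' : IsProj C y' x') : dist x x' ≤ dist u u' := by
  have h1 := hX.dist_proj_oplus_le hcl hC hl hy hy' hx hx'
  have h2 := mul_le_mul_of_nonneg_left (hT x hx.1 x' hx'.1) (by linarith [hl.2] : 0 ≤ 1 - l)
  exact le_of_mul_le_mul_left (by linarith) hl.1

theorem IsHadamard.existsUnique_isImplicitScheme (hX : IsHadamard X) {C : Set X}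
    (hne : C.Nonempty) (hcl : IsClosed C) (hC : IsConvex C) {T : X → X}
    (hT : ∀ a ∈ C, ∀ b ∈ C, dist (T a) (T b) ≤ dist a b) {α : ℕ → ℝ} {u : ℕ → X}
    (hα : ∀ m, α m ∈ Set.Ioo (0 : ℝ) 1) : ∃! x : ℕ → X, IsImplicitScheme C T α u x := by
  choose x hx using fun m => hX.exists_implicit hne hcl hC hT (hα m) (u m)
  refine ⟨x, hx, fun x' hx' => funext fun m => ?_⟩
  obtain ⟨y, hy, hp⟩ := hx m
  obtain ⟨y', hy', hp'⟩ := hx' m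
  exact dist_le_zero.1
    ((hX.dist_implicit_le hcl hC hT (hα m) hy' hp' hy hp).trans (dist_self _).le)

theorem IsHadamard.tendsto_of_isImplicitScheme (hX : IsHadamard X) {C : Set X}
    (hcl : IsClosed C) (hC : IsConvex C) {T : X → X} (hTC : Set.MapsTo T C C)
    (hT : ∀ a ∈ C, ∀ b ∈ C, dist (T a) (T b) ≤ dist a b) {o q : X}
    (hq : IsProj (fixedPts C T) o q) {α : ℕ → ℝ} {u x : ℕ → X}
    (hα : ∀ m, α m ∈ Set.Ioo (0 : ℝ) 1) (hα0 : Tendsto α atTop (𝓝 0))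
    (hu : Tendsto (fun m => dist (u m) o) atTop (𝓝 0)) (hx : IsImplicitScheme C T α u x) :
    Tendsto x atTop (𝓝 q) := by
  have hqC := hq.1.1
  choose z w hw hz using fun m => hX.exists_implicit ⟨q, hqC⟩ hcl hC hT (hα m) o
  have hTq : ∀ m, dist (T (z m)) q ≤ dist (z m) q := fun m => by
    simpa only [hq.1.2] using hT _ (hz m).1 q hqC
  have hzq : ∀ m, dist (z m) q ≤ dist o q := fun m =>
    hX.dist_implicit_le hcl hC hT (hα m) (hw m) (hz m) (hq.1.2.symm ▸ isOplus_self q)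
      (isProj_self hqC)
  have hR : ∀ m, dist o (T (z m)) ≤ 2 * dist o q := fun m => by
    linarith [dist_triangle_right o (T (z m)) q, hTq m, hzq m]
  have hzT : Tendsto (fun m => dist (z m) (T (z m))) atTop (𝓝 0) := by
    refine squeeze_zero (fun _ => dist_nonneg) (fun m =>
      (hX.dist_proj_oplus_right_le hcl hC (hw m) (hz m) (hTC (hz m).1)).trans
        (mul_le_mul_of_nonneg_left (hR m) (hα m).1.le)) ?_
    simpa using hα0.mul_const (2 * dist o q)
  have hlim : Tendsto (fun m => dist (z m) q ^ 2) atTop (𝓝 0) := by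
    refine tendsto_order.2 ⟨fun b hb => Eventually.of_forall fun m => hb.trans_le (sq_nonneg _),
      fun b hb => ?_⟩
    filter_upwards [hX.eventually_sq_dist_sub_le hcl hC hTC hT hq (fun m => (hz m).1) hR hzT
      (fun m => (hα m).1.le) hα0 (half_pos hb)] with m hm
    have h1 := hX.sq_dist_proj_oplus_le hcl hC (hα m) (hw m) (hz m) hqC
    have h2 : (1 - α m) * dist (T (z m)) q ^ 2 ≤ (1 - α m) * dist (z m) q ^ 2 := by
      have := hTq m
      have : 0 ≤ 1 - α m := by linarith [(hα m).2]
      gcongr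
    have h3 : dist (z m) q ^ 2 ≤ dist o q ^ 2 - (1 - α m) * dist o (T (z m)) ^ 2 :=
      le_of_mul_le_mul_left (by linarith) (hα m).1
    linarith
  have hlim' : Tendsto (fun m => dist (z m) q) atTop (𝓝 0) := by
    simpa [Real.sqrt_sq dist_nonneg] using hlim.sqrt
  refine tendsto_iff_dist_tendsto_zero.2 (squeeze_zero (fun _ => dist_nonneg) (fun m => ?_)
    (by simpa using hu.add hlim'))
  obtain ⟨y, hy, hp⟩ := hx m
  linarith [hX.dist_implicit_le hcl hC hT (hα m) hy hp (hw m) (hz m),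
    dist_triangle (x m) (z m) q]

/-! ### The explicit scheme -/

theorem IsExplicitScheme.mem {C : Set X} (hC : IsConvex C) {T : X → X} {α β : ℕ → ℝ}
    (hβ : ∀ n, β n ∈ Set.Ioo (0 : ℝ) 1) {u y x : ℕ → X} (hx : IsExplicitScheme C T α β u y x)
    (n : ℕ) : x n ∈ C := by
  induction n with
  | zero => exact hx.1
  | succ n ih =>
    obtain ⟨z, hz, hxz⟩ := hx.2.2 n
    exact hC.oplus_mem _ ⟨by linarith [(hβ n).2], by linarith [(hβ n).1]⟩ _ ih _ hz.1 _ hxz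

theorem IsHadamard.exists_isExplicitScheme (hX : IsHadamard X) {C : Set X}
    (hcl : IsClosed C) (hC : IsConvex C) (T : X → X) {α β : ℕ → ℝ}
    (hα : ∀ n, α n ∈ Set.Ioo (0 : ℝ) 1) (hβ : ∀ n, β n ∈ Set.Ioo (0 : ℝ) 1) (u : ℕ → X) {x₀ : X}
    (hx₀ : x₀ ∈ C) : ∃ y x : ℕ → X, x 0 = x₀ ∧ IsExplicitScheme C T α β u y x := by
  choose P hP using hX.exists_isProj ⟨x₀, hx₀⟩ hcl hC.oplus_mem
  choose m hm _ using fun n x => hX.catZero.existsUnique_isOplus (hα n).1.le (hα n).2.le (u n) x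
  choose k hk _ using fun n x z => hX.catZero.existsUnique_isOplus (l := 1 - β n)
    (by linarith [(hβ n).2]) (by linarith [(hβ n).1]) x z
  let x : ℕ → X := fun n => Nat.rec x₀ (fun n x => k n x (P (m n (T x)))) n
  exact ⟨fun n => m n (T (x n)), x, rfl, hx₀, fun n => hm n _, fun n => ⟨_, hP _, hk n _ _⟩⟩

theorem IsHadamard.dist_isExplicitScheme_succ_le (hX : IsHadamard X) {C : Set X}
    (hcl : IsClosed C) (hC : IsConvex C) {T : X → X}
    (hT : ∀ a ∈ C, ∀ b ∈ C, dist (T a) (T b) ≤ dist a b) {α β : ℕ → ℝ}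
    (hα : ∀ n, α n ∈ Set.Ioo (0 : ℝ) 1) (hβ : ∀ n, β n ∈ Set.Ioo (0 : ℝ) 1)
    {u u' y y' x x' : ℕ → X} (hx : IsExplicitScheme C T α β u y x)
    (hx' : IsExplicitScheme C T α β u' y' x') (n : ℕ) :
    dist (x (n + 1)) (x' (n + 1)) ≤
      (1 - α n * β n) * dist (x n) (x' n) + α n * β n * dist (u n) (u' n) := by
  obtain ⟨z, hz, hxz⟩ := hx.2.2 n
  obtain ⟨z', hz', hxz'⟩ := hx'.2.2 n
  obtain ⟨hα1, hα2⟩ := hα n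
  obtain ⟨hβ1, hβ2⟩ := hβ n
  have h1 := hX.catZero.dist_oplus_le (by linarith) (by linarith) hxz hxz'
  have h2 := hX.dist_proj_oplus_le hcl hC (hα n) (hx.2.1 n) (hx'.2.1 n) hz hz'
  have h3 := hT _ (hx.mem hC hβ n) _ (hx'.mem hC hβ n)
  have h4 : dist z z' ≤ α n * dist (u n) (u' n) + (1 - α n) * dist (x n) (x' n) :=
    h2.trans (by nlinarith)
  nlinarith

/-- Convergence of the explicit scheme with constant anchor `o`. The square `s n` of the distance
to `q` satisfies `s (n + 1) ≤ (1 - a n) s n + a n b n - η n` with `a n = α n β n`; whenever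
`η n` is not negligible it beats `a n b n`, and otherwise the iterates are approximate fixed
points, which forces `b n` to be asymptotically nonpositive. -/
theorem IsHadamard.tendsto_of_isExplicitScheme_const (hX : IsHadamard X) {C : Set X}
    (hcl : IsClosed C) (hC : IsConvex C) {T : X → X} (hTC : Set.MapsTo T C C)
    (hT : ∀ a ∈ C, ∀ b ∈ C, dist (T a) (T b) ≤ dist a b) {o q : X}
    (hq : IsProj (fixedPts C T) o q) {α β : ℕ → ℝ}
    (hα : ∀ n, α n ∈ Set.Ioo (0 : ℝ) 1) (hβ : ∀ n, β n ∈ Set.Ioo (0 : ℝ) 1)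
    (hα0 : Tendsto α atTop (𝓝 0)) (hαβ : ¬ Summable fun n => α n * β n) {c : ℝ} (hc : 0 < c)
    (hβc : ∀ᶠ n in atTop, c ≤ β n ∧ c ≤ 1 - β n) {y x : ℕ → X}
    (hx : IsExplicitScheme C T α β (fun _ => o) y x) : Tendsto x atTop (𝓝 q) := by
  have hqC := hq.1.1
  have hxC := hx.mem hC hβ
  choose z hz hxz using hx.2.2
  have hconst : IsExplicitScheme C T α β (fun _ => q) (fun _ => q) (fun _ => q) :=
    ⟨hqC, fun n => by simpa only [hq.1.2] using isOplus_self q,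
      fun n => ⟨q, isProj_self hqC, isOplus_self q⟩⟩
  have ha0 : ∀ n, 0 < α n * β n := fun n => mul_pos (hα n).1 (hβ n).1
  have ha1 : ∀ n, α n * β n ≤ 1 := fun n =>
    mul_le_one₀ (hα n).2.le (hβ n).1.le (hβ n).2.le
  obtain ⟨R, hxR, hoR⟩ : ∃ R, (∀ n, dist (x n) q ≤ R) ∧ dist o q ≤ R := by
    refine ⟨max (dist (x 0) q) (dist o q), fun n => ?_, le_max_right _ _⟩
    induction n with
    | zero => exact le_max_left _ _
    | succ n ih =>
      have h1 := hX.dist_isExplicitScheme_succ_le hcl hC hT hα hβ hx hconst n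
      have h2 := mul_le_mul_of_nonneg_left ih (sub_nonneg.2 (ha1 n))
      have h3 := mul_le_mul_of_nonneg_left (le_max_right (dist (x 0) q) (dist o q)) (ha0 n).le
      linarith
  have hTq : ∀ n, dist (T (x n)) q ≤ dist (x n) q := fun n => by
    simpa only [hq.1.2] using hT _ (hxC n) q hqC
  have hR : ∀ n, dist o (T (x n)) ≤ 2 * R := fun n => by
    linarith [dist_triangle_right o (T (x n)) q, hTq n, hxR n]
  set b : ℕ → ℝ := fun n => dist o q ^ 2 - (1 - α n) * dist o (T (x n)) ^ 2 with hb
  set η : ℕ → ℝ := fun n => β n * (1 - β n) * dist (x n) (z n) ^ 2 with hη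
  have hη0 : ∀ n, 0 ≤ η n := fun n =>
    mul_nonneg (mul_nonneg (hβ n).1.le (by linarith [(hβ n).2])) (sq_nonneg _)
  have hstep : ∀ n, dist (x (n + 1)) q ^ 2 ≤
      (1 - α n * β n) * dist (x n) q ^ 2 + (α n * β n * b n - η n) := by
    intro n
    obtain ⟨hα1, hα2⟩ := hα n
    obtain ⟨hβ1, hβ2⟩ := hβ n
    have h1 := hX.catZero.sq_dist_le (by linarith) (by linarith) (hxz n) q
    have h2 := hX.sq_dist_proj_oplus_le hcl hC (hα n) (hx.2.1 n) (hz n) hqC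
    have h3 : (1 - α n) * dist (T (x n)) q ^ 2 ≤ (1 - α n) * dist (x n) q ^ 2 := by
      have := hTq n
      have : 0 ≤ 1 - α n := by linarith
      gcongr
    have h4 := mul_le_mul_of_nonneg_left (h2.trans (by linarith) : dist (z n) q ^ 2 ≤
      α n * dist o q ^ 2 + (1 - α n) * dist (x n) q ^ 2 -
        α n * (1 - α n) * dist o (T (x n)) ^ 2) hβ1.le
    rw [dist_comm q, dist_comm q, dist_comm q] at h1
    simp only [hb, hη]
    linarith
  have hkey : ∀ ε > 0, ∀ᶠ n in atTop, α n * β n * b n - η n ≤ α n * β n * ε := by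
    intro ε hε
    -- On the filter `l` of the indices violating the bound, the iterates are approximate
    -- fixed points, which contradicts `ε < b n`.
    set l : Filter ℕ := atTop ⊓ 𝓟 {n | ¬ (α n * β n * b n - η n ≤ α n * β n * ε)} with hl
    have hbad : ∀ᶠ n in l, α n * β n * ε < α n * β n * b n - η n := by
      filter_upwards [mem_inf_of_right (mem_principal_self _)] with n hn using not_le.1 hn
    have hαl : Tendsto α l (𝓝 0) := hα0.mono_left inf_le_left
    have hxz0 : Tendsto (fun n => dist (x n) (z n)) l (𝓝 0) := by
      have h1 : Tendsto (fun n => √(α n * (dist o q ^ 2 / c ^ 2))) l (𝓝 0) := by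
        simpa using (hαl.mul_const (dist o q ^ 2 / c ^ 2)).sqrt
      refine squeeze_zero' (Eventually.of_forall fun _ => dist_nonneg) ?_ h1
      filter_upwards [hbad, hβc.filter_mono inf_le_left] with n hn hcn
      obtain ⟨hα1, hα2⟩ := hα n
      refine Real.le_sqrt_of_sq_le ?_
      have h2 : c ^ 2 * dist (x n) (z n) ^ 2 ≤ η n := by
        simp only [hη]
        have : c ^ 2 ≤ β n * (1 - β n) := by nlinarith
        gcongr
      have h3 : α n * β n * b n ≤ α n * β n * dist o q ^ 2 := by
        refine mul_le_mul_of_nonneg_left ?_ (ha0 n).le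
        simp only [hb]
        nlinarith [sq_nonneg (dist o (T (x n)))]
      have h4 : α n * β n * dist o q ^ 2 ≤ α n * dist o q ^ 2 := by
        refine mul_le_mul_of_nonneg_right ?_ (sq_nonneg _)
        nlinarith [(hβ n).2]
      rw [← mul_div_assoc, le_div_iff₀ (by positivity)]
      nlinarith [mul_pos (ha0 n) hε]
    have hxT : Tendsto (fun n => dist (x n) (T (x n))) l (𝓝 0) := by
      refine squeeze_zero (g := fun n => dist (x n) (z n) + α n * (2 * R))
        (fun _ => dist_nonneg) (fun n => ?_) (by simpa using hxz0.add (hαl.mul_const (2 * R)))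
      have h1 := hX.dist_proj_oplus_right_le hcl hC (hx.2.1 n) (hz n) (hTC (hxC n))
      have h2 := mul_le_mul_of_nonneg_left (hR n) (hα n).1.le
      linarith [dist_triangle (x n) (z n) (T (x n))]
    have hfalse : ∀ᶠ n in l, False := by
      filter_upwards [hbad, hX.eventually_sq_dist_sub_le hcl hC hTC hT hq hxC hR hxT
        (fun n => (hα n).1.le) hαl hε] with n hn hbn
      have := mul_le_mul_of_nonneg_left hbn (ha0 n).le
      linarith [hη0 n]
    filter_upwards [eventually_inf_principal.1 hfalse] with n hn
    exact not_not.1 hn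
  have hlim := tendsto_zero_of_eventually_le (s := fun n => dist (x n) q ^ 2)
    (fun n => sq_nonneg _) (fun n => (ha0 n).le) ha1 hαβ fun ε hε => by
      filter_upwards [hkey ε hε] with n hn
      linarith [hstep n]
  exact tendsto_iff_dist_tendsto_zero.2 (by simpa [Real.sqrt_sq dist_nonneg] using hlim.sqrt)

end CATZero

theorem mainTheorem3 {X : Type*} [MetricSpace X] (hX : CATZero.IsHadamard X) (o : X)
    (C : Set X) (hCne : C.Nonempty) (hCcl : IsClosed C) (hCconv : CATZero.IsConvex C)
    (T : X → X) (hTC : Set.MapsTo T C C)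
    (hT : ∀ a ∈ C, ∀ b ∈ C, dist (T a) (T b) ≤ dist a b)
    (hF : (CATZero.fixedPts C T).Nonempty)
    (α β : ℕ → ℝ) (hα : ∀ n, α n ∈ Set.Ioo (0 : ℝ) 1) (hβ : ∀ n, β n ∈ Set.Ioo (0 : ℝ) 1)
    (hα0 : Tendsto α atTop (𝓝 0))
    (hαsum : Tendsto (fun N => ∑ n ∈ Finset.range N, α n) atTop atTop)
    (hβinf : 0 < liminf β atTop) (hβsup : limsup β atTop < 1)
    (u : ℕ → X) (hu : Summable (fun n => α n * dist (u n) o))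
    (x y : ℕ → X) (hx : CATZero.IsExplicitScheme C T α β u y x) :
    ∃ q ∈ CATZero.fixedPts C T, Tendsto x atTop (𝓝 q) ∧
      ∀ (α' : ℕ → ℝ) (u' : ℕ → X), (∀ m, α' m ∈ Set.Ioo (0 : ℝ) 1) →
        Tendsto α' atTop (𝓝 0) → Tendsto (fun m => dist (u' m) o) atTop (𝓝 0) →
        (∃! x' : ℕ → X, CATZero.IsImplicitScheme C T α' u' x') ∧
        ∀ x' : ℕ → X, CATZero.IsImplicitScheme C T α' u' x' → Tendsto x' atTop (𝓝 q) := by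
  obtain ⟨q, hq⟩ := hX.exists_isProj hF (CATZero.isClosed_fixedPts hCcl hT)
    (hX.catZero.oplus_mem_fixedPts hCconv hT) o
  refine ⟨q, hq.1, ?_, fun α' u' hα' hα'0 hu' =>
    ⟨hX.existsUnique_isImplicitScheme hCne hCcl hCconv hT hα',
      fun x' hx' => hX.tendsto_of_isImplicitScheme hCcl hCconv hTC hT hq hα' hα'0 hu' hx'⟩⟩
  have hαdiv : ¬ Summable α :=
    (not_summable_iff_tendsto_nat_atTop_of_nonneg fun n => (hα n).1.le).2 hαsum
  obtain ⟨c₁, hc₁, hc₁'⟩ := exists_between hβinf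
  obtain ⟨c₂, hc₂, hc₂'⟩ := exists_between hβsup
  have hβ₁ : ∀ᶠ n in atTop, c₁ < β n := eventually_lt_of_lt_liminf hc₁'
    (isBoundedUnder_of ⟨0, fun n => (hβ n).1.le⟩)
  have hβ₂ : ∀ᶠ n in atTop, β n < c₂ := eventually_lt_of_limsup_lt hc₂
    (isBoundedUnder_of ⟨1, fun n => (hβ n).2.le⟩)
  have hαβ : ¬ Summable fun n => α n * β n := by
    refine fun h => hαdiv ((h.mul_left c₁⁻¹).of_norm_bounded_eventually ?_)
    rw [Nat.cofinite_eq_atTop]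
    filter_upwards [hβ₁] with n hn
    rw [Real.norm_of_nonneg (hα n).1.le, inv_mul_eq_div, le_div_iff₀ hc₁]
    exact mul_le_mul_of_nonneg_left hn.le (hα n).1.le
  obtain ⟨y', w, hw0, hw⟩ := hX.exists_isExplicitScheme hCcl hCconv T hα hβ (fun _ => o) hx.1
  have hwq : Tendsto w atTop (𝓝 q) := by
    refine hX.tendsto_of_isExplicitScheme_const hCcl hCconv hTC hT hq hα hβ hα0 hαβ
      (c := min c₁ (1 - c₂)) (lt_min hc₁ (by linarith)) ?_ hw
    filter_upwards [hβ₁, hβ₂] with n h1 h2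
    exact ⟨(min_le_left _ _).trans h1.le, (min_le_right _ _).trans (by linarith)⟩
  have hxw : Tendsto (fun n => dist (x n) (w n)) atTop (𝓝 0) := by
    refine CATZero.tendsto_zero_of_le_one_sub_mul_add (fun _ => dist_nonneg)
      (fun n => (mul_pos (hα n).1 (hβ n).1).le) hαβ
      (fun n => mul_nonneg (hα n).1.le dist_nonneg) hu fun n => ?_
    have h1 := hX.dist_isExplicitScheme_succ_le hCcl hCconv hT hα hβ hx hw n
    have h2 : α n * β n * dist (u n) o ≤ α n * dist (u n) o :=
      mul_le_mul_of_nonneg_right (mul_le_of_le_one_right (hα n).1.le (hβ n).2.le) dist_nonneg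
    linarith
  refine tendsto_iff_dist_tendsto_zero.2 (squeeze_zero (fun _ => dist_nonneg)
    (fun n => dist_triangle (x n) (w n) q) ?_)
  simpa using hxw.add (tendsto_iff_dist_tendsto_zero.1 hwq)
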